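/- **Setting.** A tract is a commutative monoid $F$ with an absorbing element $0$ and unit group $F^\times=F\setminus\{0\}$, together with a subset $N_F\subseteq\mathbb N[F^\times]$ such that $0\in N_F$, $1\notin N_F$, there is a unique $\epsilon\in F^\times$ with $1+\epsilon\in N_F$, and $F^\times\cdot N_F\subseteq N_F$. In formal sums of elements of $F$, zero terms are omitted. Fix a tract $F$, an involution $\tau$ of $F$ (a multiplicative map $\tau:F\to F$ with $\tau(0)=0$, $\tau(1)=1$, $\tau^2=\mathrm{id}$, and $\sum\tau(a_i)\in N_F$ whenever $\sum a_i\in N_F$), and $E=\{1,\dots,n\}$, $n\ge 0$. For functions $\nu:E^w\to F$ and $\mu:E^r\to F$, the Plücker flag relations for $(\nu,\mu)$ are $$\sum_{k=1}^{w+1}\epsilon^k\,\nu(y_1,\dots,\widehat{y_k},\dots,y_{w+1})\,\mu(y_k,x_1,\dots,x_{r-1})\in N_F\qquad\text{for all } y_1,\dots,y_{w+1},x_1,\dots,x_{r-1}\in E$$ (no condition if $r=0$). A Grassmann–Plücker function of rank $r$ is a function $\varphi:E^r\to F$ that is not identically zero, is alternating (exchanging two arguments multiplies the value by $\epsilon$,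 and the value is $0$ if two arguments coincide), and satisfies the Plücker flag relations for $(\varphi,\varphi)$. An $F$-matroid of rank $r$ on $E$ is a class $M=[\varphi]$ of such functions up to multiplication by elements of $F^\times$. Its underlying matroid $\underline M$ has as bases the sets $\{x_1,\dots,x_r\}$ with $\varphi(x_1,\dots,x_r)\ne0$. The set $\mathcal C(M)\subseteq F^E$ of circuits of $M$ consists of all $a X_C$ with $a\in F^\times$ and $C$ a circuit of $\underline M$, where, for $y_0\in C$ and a basis $\{y_1,\dots,y_r\}$ of $\underline M$ containing $C\setminus\{y_0\}$, $X_C(y_i)=\epsilon^i\varphi(y_0,\dots,\widehat{y_i},\dots,y_r)$ and $X_C(e)=0$ for $e\notin\{y_0,\dots,y_r\}$; up to a factor in $F^\times$, $X_C$ does not depend on the choices. The dual is $M^*=[\varphi^*]$, where $\varphi^*:E^{n-r}\to F$ is the alternating function with $\varphi^*(x_1,\dots,x_{n-r})=\operatorname{sign}(x_1,\dots,x_{n-r},x_1',\dots,x_r')\,\tau(\varphi(x_1',\dots,x_r'))$ whenever $E=\{x_1,\dots,x_{n-r},x_1',\dots,x_r'\}$; here $\operatorname{sign}$ is the sign of the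 permutation, with $-1$ read as $\epsilon$. The cocircuits of $M$ are $\mathcal C^*(M)=\mathcal C(M^*)$. Vectors $X,Y\in F^E$ are orthogonal, $X\perp Y$, if $\sum_{e\in E}X_e\,\tau(Y_e)\in N_F$; two sets of vectors are orthogonal if all their members are. The set of covectors of $M$ is $\mathcal V^*(M)=\{X\in F^E: X\perp Y\text{ for all }Y\in\mathcal C(M)\}$. For $F$-matroids $M,N$ on $E$, $M$ is a quotient of $N$, written $N\twoheadrightarrow M$, if all Grassmann–Plücker functions $\mu$ representing $M$ and $\nu$ representing $N$ satisfy the Plücker flag relations for $(\nu,\mu)$. A sequence $(M_1,\dots,M_s)$ of $F$-matroids on $E$ is a flag $F$-matroid if $M_j\twoheadrightarrow M_i$ for all $1\le i<j\le s$. **Theorem.** (a) For every sequence $(M_1,\dots,M_s)$ of $F$-matroids on $E$ (of arbitrary ranks), the following are equivalent: 1. $(M_1,\dots,M_s)$ is a flag $F$-matroid; 2. $\mathcal C^*(M_i)\subseteq\mathcal V^*(M_j)$ for all $1\le i<j\le s$; 3. $\mathcal C^*(M_i)\perp\mathcal C(M_j)$ for all $1\le i<j\le s$. (b) For any two $F$-matroids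 $M$ and $N$ on $E$, $N\twoheadrightarrow M$ if and only if $\mathcal C^*(M)\subseteq\mathcal V^*(N)$. -/

import Mathlib

/-- A tract: a commutative pointed monoid `F` with `Fˣ = F \ {0}`, together with a nullset
`null ⊆ ℕ[Fˣ]` in the group semiring of its unit group. -/
class Tract (F : Type*) extends CommGroupWithZero F where
  null : Set (MonoidAlgebra ℕ Fˣ)
  zero_mem_null : 0 ∈ null
  one_notMem_null : 1 ∉ null
  existsUnique_eps : ∃! u : Fˣ, 1 + MonoidAlgebra.single u 1 ∈ null
  smul_mem_null : ∀ (u : Fˣ) (a : MonoidAlgebra ℕ Fˣ), a ∈ null →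
    MonoidAlgebra.single u 1 * a ∈ null

namespace Tract

/-- The unique unit `ε` with `1 + ε` in the nullset, regarded as an element of `F`. -/
noncomputable def eps (F : Type*) [Tract F] : F :=
  ((existsUnique_eps (F := F)).choose : F)

open Classical in
/-- An element of `F` as an element of `ℕ[Fˣ]`: a unit goes to the corresponding basis element,
and `0` goes to `0`. -/
noncomputable def formal {F : Type*} [Tract F] (a : F) : MonoidAlgebra ℕ Fˣ :=
  if h : a = 0 then 0 else MonoidAlgebra.single (Units.mk0 a h) 1

open Classical in
/-- A sign `±1` as an element of `F`, identifying `-1` with `ε`. -/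
noncomputable def ofSign (F : Type*) [Tract F] (s : ℤˣ) : F :=
  if s = 1 then 1 else eps F

variable {F : Type*} [Tract F]

theorem formal_zero : formal (0 : F) = 0 := by simp [formal]

theorem formal_unit (u : Fˣ) : formal (u : F) = MonoidAlgebra.single u 1 := by
  simp [formal]

theorem formal_mul (u : Fˣ) (a : F) :
    formal ((u : F) * a) = MonoidAlgebra.single u 1 * formal a := by
  rcases eq_or_ne a 0 with rfl | h
  · simp [formal_zero]
  · lift a to Fˣ using h.isUnit
    rw [← Units.val_mul, formal_unit, formal_unit]; simp

theorem sum_mul_mem_null {ι : Type*} (s : Finset ι) (f : ι → F) (c : F)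
    (h : ∑ i ∈ s, formal (f i) ∈ null (F := F)) :
    ∑ i ∈ s, formal (c * f i) ∈ null (F := F) := by
  rcases eq_or_ne c 0 with rfl | hc
  · simpa [formal_zero] using zero_mem_null (F := F)
  · lift c to Fˣ using hc.isUnit
    simp_rw [formal_mul, ← Finset.mul_sum]
    exact smul_mem_null _ _ h

theorem formal_notMem_null {a : F} (h : a ≠ 0) : formal a ∉ null (F := F) := by
  lift a to Fˣ using h.isUnit
  intro ha
  have := smul_mem_null a⁻¹ _ ha
  rw [← formal_mul] at this
  apply one_notMem_null (F := F)
  simpa [formal, MonoidAlgebra.one_def] using this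

theorem eps_ne_zero : eps F ≠ 0 := Units.ne_zero _

theorem one_add_eps_mem : formal (1 : F) + formal (eps F) ∈ null (F := F) := by
  have h := (existsUnique_eps (F := F)).choose_spec.1
  rw [eps, formal_unit]
  simpa [formal, MonoidAlgebra.one_def] using h

theorem eq_eps {a : F} (h : formal (1 : F) + formal a ∈ null (F := F)) : a = eps F := by
  rcases eq_or_ne a 0 with rfl | h0
  · rw [formal_zero, add_zero] at h
    exact absurd h (formal_notMem_null one_ne_zero)
  · lift a to Fˣ using h0.isUnit
    rw [eps]
    congr 1
    apply (existsUnique_eps (F := F)).unique _ (existsUnique_eps (F := F)).choose_spec.1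
    rw [← formal_unit]
    simpa [formal, MonoidAlgebra.one_def] using h

theorem add_eps_mem (a : F) : formal a + formal (eps F * a) ∈ null (F := F) := by
  have h := sum_mul_mem_null (F := F) Finset.univ ![1, eps F] a
    (by simpa [Fin.sum_univ_two] using one_add_eps_mem (F := F))
  simpa [Fin.sum_univ_two, mul_comm] using h

theorem eps_mul_eps : eps F * eps F = 1 := by
  have h := add_eps_mem ((eps F)⁻¹)
  rw [mul_inv_cancel₀ eps_ne_zero, add_comm] at h
  have := eq_eps h
  nth_rewrite 1 [← this]
  exact inv_mul_cancel₀ eps_ne_zero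

theorem ofSign_one : ofSign F 1 = 1 := by simp [ofSign]

theorem ofSign_neg_one : ofSign F (-1) = eps F := by
  have : (-1 : ℤˣ) ≠ 1 := by decide
  simp [ofSign, this]

theorem ofSign_mul (s t : ℤˣ) : ofSign F (s * t) = ofSign F s * ofSign F t := by
  rcases Int.units_eq_one_or s with rfl | rfl <;> rcases Int.units_eq_one_or t with rfl | rfl <;>
    simp [ofSign_one, ofSign_neg_one, eps_mul_eps]

theorem ofSign_neg_one_pow (k : ℕ) : ofSign F ((-1) ^ k) = eps F ^ k := by
  induction k with
  | zero => simp [ofSign_one]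
  | succ k ih => rw [pow_succ, ofSign_mul, ih, ofSign_neg_one, pow_succ]

theorem ofSign_mul_self (s : ℤˣ) : ofSign F s * ofSign F s = 1 := by
  rw [← ofSign_mul, Int.units_mul_self, ofSign_one]

theorem ofSign_ne_zero (s : ℤˣ) : ofSign F s ≠ 0 := fun h => by
  have := ofSign_mul_self (F := F) s
  simp [h] at this

end Tract

/-- A morphism of tracts: a multiplicative map with `0 ↦ 0` and `1 ↦ 1` whose extension to formal
sums maps the nullset of `F` into the nullset of `F'`. -/
structure TractHom (F F' : Type*) [Tract F] [Tract F'] extends F →*₀ F' where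
  map_null : ∀ a ∈ Tract.null (F := F),
    MonoidAlgebra.mapDomain (Units.map (toMonoidWithZeroHom : F →* F')) a ∈ Tract.null (F := F')

namespace TractHom

open Tract

variable {F : Type*} [Tract F]

instance (F F' : Type*) [Tract F] [Tract F'] : CoeFun (TractHom F F') (fun _ => F → F') :=
  ⟨fun f => f.toMonoidWithZeroHom⟩

/-- An involution of `F`: a tract morphism `τ : F → F` whose square is the identity. -/
def IsInvolution (τ : TractHom F F) : Prop := ∀ a, τ (τ a) = a

theorem mapDomain_formal (τ : TractHom F F) (a : F) :
    MonoidAlgebra.mapDomain (Units.map (τ.toMonoidWithZeroHom : F →* F)) (formal a)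
      = formal (τ a) := by
  rcases eq_or_ne a 0 with rfl | h
  · simp [formal_zero]
  · lift a to Fˣ using h.isUnit
    have : τ (a : F) = ((Units.map (τ.toMonoidWithZeroHom : F →* F) a : Fˣ) : F) := rfl
    rw [this, formal_unit, formal_unit, MonoidAlgebra.mapDomain_single]

theorem sum_mem_null (τ : TractHom F F) {ι : Type*} (s : Finset ι) (f : ι → F)
    (h : ∑ i ∈ s, formal (f i) ∈ null (F := F)) :
    ∑ i ∈ s, formal (τ (f i)) ∈ null (F := F) := by
  have := τ.map_null _ h
  have key : ∀ t : Finset ι, MonoidAlgebra.mapDomain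
      (Units.map (τ.toMonoidWithZeroHom : F →* F)) (∑ i ∈ t, formal (f i))
        = ∑ i ∈ t, formal (τ (f i)) := by
    classical
    intro t
    induction t using Finset.induction_on with
    | empty => simp
    | insert a t ha ih =>
      rw [Finset.sum_insert ha, Finset.sum_insert ha, MonoidAlgebra.mapDomain_add, ih,
        mapDomain_formal]
  rwa [key] at this

theorem map_eps (τ : TractHom F F) : τ (eps F) = eps F := by
  apply eq_eps
  have := τ.sum_mem_null Finset.univ ![1, eps F]
    (by simpa [Fin.sum_univ_two] using one_add_eps_mem (F := F))
  simpa [Fin.sum_univ_two] using this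

theorem map_ofSign (τ : TractHom F F) (s : ℤˣ) : τ (ofSign F s) = ofSign F s := by
  rcases Int.units_eq_one_or s with rfl | rfl
  · rw [ofSign_one]; exact map_one τ.toMonoidWithZeroHom
  · rw [ofSign_neg_one, map_eps]

end TractHom

open Tract

/-- The Plücker flag relations for `ν` and `μ`: for all `y_1, …, y_{w+1}` and `x_1, …, x_{r-1}`,
the formal sum `∑ₖ εᵏ ν(y_1, …, ŷ_k, …, y_{w+1}) μ(y_k, x_1, …, x_{r-1})` is in the nullset.
The index `k : Fin (w + 1)` counts from `0`. For `r = 0` there are no tuples `x_1, …, x_{r-1}`,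
hence no relations. -/
def PluckerFlagRelations {F : Type*} [Tract F] {n w r : ℕ}
    (ν : (Fin w → Fin n) → F) (μ : (Fin r → Fin n) → F) : Prop :=
  ∀ (m : ℕ) (h : r = m + 1) (y : Fin (w + 1) → Fin n) (x : Fin m → Fin n),
    ∑ k : Fin (w + 1), formal (eps F ^ (k.val + 1) * ν (fun j => y (k.succAbove j)) *
      μ (fun j => (Fin.cons (y k) x : Fin (m + 1) → Fin n) (Fin.cast h j))) ∈ null (F := F)

/-- Alternating functions with values in a tract. -/
structure IsAlternating {F : Type*} [Tract F] {n r : ℕ} (φ : (Fin r → Fin n) → F) : Prop where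
  map_swap : ∀ (x : Fin r → Fin n) (i j : Fin r), i ≠ j →
    φ (x ∘ Equiv.swap i j) = eps F * φ x
  map_eq_zero : ∀ (x : Fin r → Fin n) (i j : Fin r), i ≠ j → x i = x j → φ x = 0

/-- Grassmann–Plücker functions of rank `r` on `E = Fin n` with coefficients in `F`. -/
structure IsGrassmannPlucker {F : Type*} [Tract F] {n r : ℕ} (φ : (Fin r → Fin n) → F) :
    Prop where
  ne_zero : ∃ x, φ x ≠ 0
  alternating : IsAlternating φ
  plucker : PluckerFlagRelations φ φ

namespace IsAlternating

variable {F : Type*} [Tract F] {n r : ℕ} {φ : (Fin r → Fin n) → F}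

theorem injective (h : IsAlternating φ) {x : Fin r → Fin n} (hx : φ x ≠ 0) :
    Function.Injective x := by
  intro i j hij
  by_contra hne
  exact hx (h.map_eq_zero x i j hne hij)

theorem map_perm (h : IsAlternating φ) (x : Fin r → Fin n) (π : Equiv.Perm (Fin r)) :
    φ (x ∘ π) = ofSign F (Equiv.Perm.sign π) * φ x := by
  induction π using Equiv.Perm.swap_induction_on' with
  | one => simp [ofSign_one]
  | mul_swap f i j hij ih =>
    rw [Equiv.Perm.coe_mul, ← Function.comp_assoc, h.map_swap _ _ _ hij, ih, Equiv.Perm.sign_mul,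
      Equiv.Perm.sign_swap hij, ofSign_mul, ofSign_neg_one,
      ← mul_assoc, mul_comm (eps F)]

theorem of_range_eq (h : IsAlternating φ) {x x' : Fin r → Fin n} (hx : Function.Injective x)
    (hx' : Function.Injective x') (hr : Set.range x = Set.range x') :
    ∃ π : Equiv.Perm (Fin r), x' = x ∘ π ∧ φ x' = ofSign F (Equiv.Perm.sign π) * φ x := by
  let π : Equiv.Perm (Fin r) := (Equiv.ofInjective x' hx').trans
    ((Equiv.setCongr hr.symm).trans (Equiv.ofInjective x hx).symm)
  have hπ : x' = x ∘ π := by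
    funext i
    simp [π, Equiv.apply_ofInjective_symm]
  exact ⟨π, hπ, by rw [hπ, h.map_perm]⟩

/-- The `k`-th term of a Plücker relation, written through a permutation moving `0` to `k`. -/
theorem pow_mul_succAbove (h : IsAlternating φ) (y : Fin (r + 1) → Fin n) (k : Fin (r + 1))
    (ρ : Equiv.Perm (Fin (r + 1))) (hρ : ρ 0 = k) :
    eps F ^ k.val * φ (fun j => y (k.succAbove j))
      = ofSign F (Equiv.Perm.sign ρ) * φ (fun j => y (ρ j.succ)) := by
  obtain ⟨⟨p, σ⟩, hσ⟩ := (Equiv.Perm.decomposeFin.symm).surjective (k.cycleRange * ρ)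
  have h0 : p = 0 := by
    have := congrArg (fun f => f 0) hσ
    simpa [hρ] using this
  subst h0
  have hs : ∀ j : Fin r, ρ j.succ = k.succAbove (σ j) := by
    intro j
    have := congrArg (fun f => f j.succ) hσ
    simp only [Equiv.Perm.decomposeFin_symm_apply_succ, Equiv.swap_self, Equiv.refl_apply,
      Equiv.Perm.coe_mul, Function.comp_apply] at this
    rw [← Fin.cycleRange_symm_succ, this, Equiv.symm_apply_apply]
  have hsign : Equiv.Perm.sign ρ = (-1) ^ k.val * Equiv.Perm.sign σ := by
    have := congrArg Equiv.Perm.sign hσ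
    rw [Equiv.Perm.sign_mul, Fin.sign_cycleRange] at this
    simp only [Equiv.Perm.decomposeFin.symm_sign, if_true, one_mul] at this
    rw [this, ← mul_assoc, ← mul_pow]
    simp
  have hφ : φ (fun j => y (ρ j.succ)) = ofSign F (Equiv.Perm.sign σ) *
      φ (fun j => y (k.succAbove j)) := by
    rw [← h.map_perm]
    congr 1
    funext j
    simp [hs]
  rw [hφ, hsign, ofSign_mul, ofSign_neg_one_pow]
  rw [mul_assoc, ← mul_assoc (ofSign F _), ofSign_mul_self, one_mul]

theorem sum_mem_null_of_eq (h : IsAlternating φ) (y : Fin (r + 1) → Fin n) (a b : Fin (r + 1))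
    (hab : a ≠ b) (hy : y a = y b) (g : Fin (r + 1) → F) (hg : g a = g b) :
    ∑ k : Fin (r + 1), formal (eps F ^ (k.val + 1) * φ (fun j => y (k.succAbove j)) * g k)
      ∈ null (F := F) := by
  have hz : ∀ k, k ∉ ({a, b} : Finset (Fin (r + 1))) →
      formal (eps F ^ (k.val + 1) * φ (fun j => y (k.succAbove j)) * g k) = 0 := by
    intro k hk
    simp only [Finset.mem_insert, Finset.mem_singleton, not_or] at hk
    obtain ⟨i, hi⟩ := Fin.exists_succAbove_eq (Ne.symm hk.1)
    obtain ⟨j, hj⟩ := Fin.exists_succAbove_eq (Ne.symm hk.2)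
    have : φ (fun j => y (k.succAbove j)) = 0 :=
      h.map_eq_zero _ i j (by rintro rfl; exact hab (hi.symm.trans hj)) (by simp [hi, hj, hy])
    simp [this, formal_zero]
  rw [← Finset.sum_subset (Finset.subset_univ {a, b}) (fun k _ hk => hz k hk),
    Finset.sum_pair hab]
  have ha := h.pow_mul_succAbove y a (Equiv.swap 0 a) (by simp)
  have hb := h.pow_mul_succAbove y b (Equiv.swap a b * Equiv.swap 0 a) (by simp)
  have hyy : ∀ i, y (Equiv.swap a b i) = y i := by
    intro i
    rcases eq_or_ne i a with rfl | hia
    · simp [hy]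
    · rcases eq_or_ne i b with rfl | hib
      · simp [hy]
      · rw [Equiv.swap_apply_of_ne_of_ne hia hib]
  simp only [Equiv.Perm.coe_mul, Function.comp_apply, hyy] at hb
  rw [Equiv.Perm.sign_mul, Equiv.Perm.sign_swap hab, ofSign_mul, ofSign_neg_one, mul_assoc, ← ha]
    at hb
  have key : eps F ^ (b.val + 1) * φ (fun j => y (b.succAbove j)) * g b =
      eps F * (eps F ^ (a.val + 1) * φ (fun j => y (a.succAbove j)) * g a) := by
    rw [pow_succ', mul_assoc (eps F), hb, hg]
    simp only [pow_succ', mul_assoc]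
  rw [key]
  exact add_eps_mem _

end IsAlternating

namespace IsGrassmannPlucker

variable {F : Type*} [Tract F] {n r : ℕ} {φ : (Fin r → Fin n) → F}

theorem rank_le (h : IsGrassmannPlucker φ) : r ≤ n := by
  obtain ⟨x, hx⟩ := h.ne_zero
  simpa using Fintype.card_le_of_injective x (h.alternating.injective hx)

theorem exchange (h : IsGrassmannPlucker φ) :
    Matroid.ExchangeProperty (fun B : Set (Fin n) => ∃ x, φ x ≠ 0 ∧ Set.range x = B) := by
  rintro X Y ⟨x, hx, rfl⟩ ⟨y, hy, rfl⟩ a ⟨⟨i, rfl⟩, haY⟩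
  have hxi := h.alternating.injective hx
  obtain ⟨m, rfl⟩ : ∃ m, r = m + 1 := ⟨r - 1, by have := i.pos; omega⟩
  have hrange : ∀ b, Set.range (Fin.cons b (x ∘ i.succAbove) : Fin (m + 1) → Fin n)
      = insert b (Set.range x \ {x i}) := by
    intro b
    rw [Fin.range_cons, Set.range_comp, Fin.range_succAbove, Set.compl_eq_univ_sdiff, Set.image_sdiff hxi,
      Set.image_univ, Set.image_singleton]
  have hsum := h.plucker m rfl (Fin.cons (x i) y) (x ∘ i.succAbove)
  rw [Fin.sum_univ_succ] at hsum
  by_contra hcon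
  push Not at hcon
  have hzero : ∀ j : Fin (m + 1), φ (Fin.cons (y j) (x ∘ i.succAbove)) = 0 := by
    intro j
    by_contra hne
    have hinj := h.alternating.injective hne
    refine hcon (y j) ⟨⟨j, rfl⟩, ?_⟩ _ hne (hrange _)
    rintro ⟨l, hl⟩
    rcases eq_or_ne l i with rfl | hli
    · exact haY ⟨j, hl.symm⟩
    · obtain ⟨l', rfl⟩ := Fin.exists_succAbove_eq hli
      have := @hinj 0 l'.succ (by simp [hl])
      exact absurd this.symm (Fin.succ_ne_zero l')
  have h0 : φ (Fin.cons (x i) (x ∘ i.succAbove)) ≠ 0 := by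
    have hinj : Function.Injective (Fin.cons (x i) (x ∘ i.succAbove) : Fin (m + 1) → Fin n) := by
      rw [Fin.cons_injective_iff]
      refine ⟨?_, hxi.comp Fin.succAbove_right_injective⟩
      rintro ⟨l, hl⟩
      exact Fin.succAbove_ne i l (hxi hl)
    obtain ⟨π, -, hπ⟩ := h.alternating.of_range_eq hxi hinj (by
      rw [hrange, Set.insert_sdiff_singleton, Set.insert_eq_of_mem (Set.mem_range_self i)])
    rw [hπ]
    exact mul_ne_zero (ofSign_ne_zero _) hx
  rw [Finset.sum_eq_zero, add_zero] at hsum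
  · refine formal_notMem_null ?_ hsum
    refine mul_ne_zero (mul_ne_zero (pow_ne_zero _ eps_ne_zero) ?_) ?_
    · simpa using hy
    · simpa using h0
  · intro j _
    have := hzero j
    simp [this, formal_zero]

/-- The underlying matroid of a Grassmann–Plücker function: its bases are the sets
`{x_1, …, x_r}` with `φ(x_1, …, x_r) ≠ 0`. -/
def underlying (h : IsGrassmannPlucker φ) : Matroid (Fin n) :=
  Matroid.ofIsBaseOfFinite (E := Set.univ) Set.finite_univ
    (fun B => ∃ x, φ x ≠ 0 ∧ Set.range x = B)
    (by obtain ⟨x, hx⟩ := h.ne_zero; exact ⟨_, x, hx, rfl⟩)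
    h.exchange (fun _ _ => Set.subset_univ _)

end IsGrassmannPlucker

/-- The sign of an enumeration `x_1, …, x_m` of `E = Fin n` (so `m = n`), i.e. the sign of the
permutation that sorts it. -/
noncomputable def enumSign {m n : ℕ} (x : Fin m → Fin n) (hx : Function.Bijective x) : ℤˣ :=
  Equiv.Perm.sign ((Equiv.ofBijective x hx).trans
    (finCongr (Fin.equiv_iff_eq.mp ⟨Equiv.ofBijective x hx⟩).symm))

theorem enumSign_comp {m n : ℕ} (x y : Fin m → Fin n) (hx : Function.Bijective x)
    (hy : Function.Bijective y) (π : Equiv.Perm (Fin m)) (h : y = x ∘ π) :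
    enumSign y hy = enumSign x hx * Equiv.Perm.sign π := by
  obtain rfl : m = n := Fin.equiv_iff_eq.mp ⟨Equiv.ofBijective x hx⟩
  rw [enumSign, enumSign, ← Equiv.Perm.sign_mul]
  congr 1
  ext i
  simp [h]

theorem comp_enumSign {m n : ℕ} (x y : Fin m → Fin n) (hx : Function.Bijective x)
    (hy : Function.Bijective y) (ρ : Equiv.Perm (Fin n)) (h : y = ρ ∘ x) :
    enumSign y hy = Equiv.Perm.sign ρ * enumSign x hx := by
  obtain rfl : m = n := Fin.equiv_iff_eq.mp ⟨Equiv.ofBijective x hx⟩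
  rw [enumSign, enumSign, ← Equiv.Perm.sign_mul]
  congr 1
  ext i
  simp [h]

open Classical in
/-- The dual function `φ*(x) = sign(x, x') · τ(φ(x'))` whenever `x, x'` together enumerate `E`
without repetition; it is `0` if there is no such `x'`. It is used for `k = n - r`. The value does
not depend on the chosen `x'`, see `dualFun_eq`. -/
noncomputable def dualFun {F : Type*} [Tract F] (τ : TractHom F F) {n r k : ℕ}
    (φ : (Fin r → Fin n) → F) (x : Fin k → Fin n) : F :=
  if h : ∃ x' : Fin r → Fin n, Function.Bijective (Fin.append x x') then
    ofSign F (enumSign (Fin.append x h.choose) h.choose_spec) * τ (φ h.choose)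
  else 0

section dual

variable {F : Type*} [Tract F] {n r k : ℕ}

theorem range_eq_compl_of_append {x : Fin k → Fin n} {x' : Fin r → Fin n}
    (h : Function.Bijective (Fin.append x x')) : Set.range x' = (Set.range x)ᶜ := by
  have hi := Fin.append_injective_iff.mp h.1
  ext e
  constructor
  · rintro ⟨i, rfl⟩ ⟨j, hj⟩
    exact hi.2.2 j i hj
  · intro he
    obtain ⟨i, hi⟩ := h.2 e
    induction i using Fin.addCases with
    | left i => exact absurd ⟨i, by simpa using hi⟩ he
    | right i => exact ⟨i, by simpa using hi⟩

theorem exists_append_bijective (hk : k + r = n) {x : Fin k → Fin n}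
    (hx : Function.Injective x) : ∃ x' : Fin r → Fin n, Function.Bijective (Fin.append x x') := by
  classical
  have hc : Fintype.card (Fin r) = Fintype.card {e // e ∉ Set.range x} := by
    have := Set.card_range_of_injective hx
    rw [Fintype.card_subtype_compl]
    simp only [Fintype.card_fin] at this ⊢
    have h2 : Fintype.card {e // e ∈ Set.range x} = k := by
      exact (Fintype.card_congr (Equiv.refl _)).trans this
    omega
  let e := Fintype.equivOfCardEq hc
  refine ⟨fun i => (e i : Fin n), ?_⟩
  rw [Fintype.bijective_iff_injective_and_card]
  refine ⟨Fin.append_injective_iff.mpr ⟨hx, Subtype.val_injective.comp e.injective, ?_⟩,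
    by simpa using hk⟩
  intro i j hij
  exact (e j).2 ⟨i, hij⟩

theorem append_comp_perm (x : Fin k → Fin n) (x' : Fin r → Fin n) (π : Equiv.Perm (Fin k))
    (π' : Equiv.Perm (Fin r)) :
    Fin.append (x ∘ π) (x' ∘ π') =
      Fin.append x x' ∘ finSumFinEquiv.permCongr (Equiv.Perm.sumCongr π π') := by
  funext i
  induction i using Fin.addCases <;> simp [Equiv.permCongr_apply]

theorem dualFun_eq (τ : TractHom F F) {φ : (Fin r → Fin n) → F} (hφ : IsAlternating φ)
    (x : Fin k → Fin n) (x' : Fin r → Fin n) (h : Function.Bijective (Fin.append x x')) :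
    dualFun τ φ x = ofSign F (enumSign (Fin.append x x') h) * τ (φ x') := by
  have hex : ∃ x' : Fin r → Fin n, Function.Bijective (Fin.append x x') := ⟨x', h⟩
  rw [dualFun, dif_pos hex]
  generalize_proofs h2
  obtain ⟨π, hπ, hs⟩ := hφ.of_range_eq (Fin.append_injective_iff.mp h.1).2.1
    (Fin.append_injective_iff.mp h2.1).2.1
    ((range_eq_compl_of_append h).trans (range_eq_compl_of_append h2).symm)
  have := enumSign_comp _ _ h h2 (finSumFinEquiv.permCongr (Equiv.Perm.sumCongr 1 π))
    (by rw [← append_comp_perm, ← hπ]; rfl)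
  rw [this, Equiv.Perm.sign_permCongr, Equiv.Perm.sign_sumCongr, hs, Equiv.Perm.sign_one, one_mul,
    ofSign_mul]
  have hm : τ (ofSign F (Equiv.Perm.sign π) * φ x')
      = τ (ofSign F (Equiv.Perm.sign π)) * τ (φ x') := map_mul τ.toMonoidWithZeroHom _ _
  rw [hm, τ.map_ofSign, mul_assoc, ← mul_assoc (ofSign F (Equiv.Perm.sign π)), ofSign_mul_self,
    one_mul]

theorem dualFun_eq_zero (τ : TractHom F F) (φ : (Fin r → Fin n) → F) {x : Fin k → Fin n}
    (h : ¬ Function.Injective x) : dualFun τ φ x = 0 := by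
  rw [dualFun, dif_neg]
  rintro ⟨x', hx'⟩
  exact h (Fin.append_injective_iff.mp hx'.1).1

theorem IsAlternating.dual (τ : TractHom F F) {φ : (Fin r → Fin n) → F} (hφ : IsAlternating φ)
    (hk : k + r = n) : IsAlternating (dualFun τ φ : (Fin k → Fin n) → F) where
  map_swap x i j hij := by
    by_cases hx : Function.Injective x
    · obtain ⟨x', hx'⟩ := exists_append_bijective hk hx
      have he : Fin.append (x ∘ Equiv.swap i j) x' = Fin.append x x' ∘
          finSumFinEquiv.permCongr (Equiv.Perm.sumCongr (Equiv.swap i j) 1) := by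
        rw [← append_comp_perm]; rfl
      have hb : Function.Bijective (Fin.append (x ∘ Equiv.swap i j) x') := by
        rw [he]; exact hx'.comp (Equiv.bijective _)
      rw [dualFun_eq τ hφ _ _ hx', dualFun_eq τ hφ _ _ hb, enumSign_comp _ _ hx' hb _ he,
        Equiv.Perm.sign_permCongr, Equiv.Perm.sign_sumCongr, Equiv.Perm.sign_swap hij,
        Equiv.Perm.sign_one, mul_one, ofSign_mul, ofSign_neg_one, mul_comm (ofSign F _), mul_assoc]
    · rw [dualFun_eq_zero τ φ hx, dualFun_eq_zero τ φ, mul_zero]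
      intro h
      exact hx (by simpa using h)
  map_eq_zero x i j hij hx := dualFun_eq_zero τ φ (fun h => hij (h hx))

/-- Moving the `i`-th entry of the first block to the front of the second block. -/
theorem enumSign_move_left {p q : ℕ} (z : Fin (p + 1) → Fin n) (x : Fin q → Fin n)
    (hZ : Function.Bijective (Fin.append z x)) :
    ∃ c : ℤˣ, ∀ i : Fin (p + 1), ∃ h : Function.Bijective
      (Fin.append (fun j => z (i.succAbove j)) (Fin.cons (z i) x : Fin (q + 1) → Fin n)),
      enumSign _ h = (-1) ^ i.val * c := by
  let Z : Fin (p + 1) ⊕ Fin q ≃ Fin n := finSumFinEquiv.trans (Equiv.ofBijective _ hZ)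
  have hZl : ∀ i, Z (Sum.inl i) = z i := fun i => by simp [Z]
  have hZr : ∀ i, Z (Sum.inr i) = x i := fun i => by simp [Z]
  have hzx := Fin.append_injective_iff.mp hZ.1
  have hcard : p + 1 + q = n := by
    simpa using Fintype.card_of_bijective hZ
  have hb : Function.Bijective (Fin.append (fun j => z ((0 : Fin (p + 1)).succAbove j))
      (Fin.cons (z 0) x : Fin (q + 1) → Fin n)) := by
    rw [Fintype.bijective_iff_injective_and_card]
    refine ⟨Fin.append_injective_iff.mpr
      ⟨hzx.1.comp Fin.succAbove_right_injective, ?_, ?_⟩, by simp; omega⟩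
    · rw [Fin.cons_injective_iff]
      exact ⟨fun ⟨j, hj⟩ => hzx.2.2 0 j hj.symm, hzx.2.1⟩
    · intro a b hab
      induction b using Fin.cases with
      | zero => exact Fin.succAbove_ne 0 a (hzx.1 (by simpa using hab))
      | succ b => exact hzx.2.2 _ b (by simpa using hab)
  refine ⟨enumSign _ hb, fun i => ?_⟩
  let ρ : Equiv.Perm (Fin n) := Z.permCongr (Equiv.Perm.sumCongr i.cycleRange.symm 1)
  have hρz : ∀ j, ρ (z j) = z (i.cycleRange.symm j) := by
    intro j
    simp [ρ, Equiv.permCongr_apply, ← hZl]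
  have hρx : ∀ j, ρ (x j) = x j := by
    intro j
    simp [ρ, Equiv.permCongr_apply, ← hZr]
  have he : Fin.append (fun j => z (i.succAbove j)) (Fin.cons (z i) x : Fin (q + 1) → Fin n)
      = ρ ∘ Fin.append (fun j => z ((0 : Fin (p + 1)).succAbove j)) (Fin.cons (z 0) x) := by
    funext a
    induction a using Fin.addCases with
    | left a => simp [hρz]
    | right a =>
      induction a using Fin.cases with
      | zero => simp [hρz]
      | succ a => simp [hρx]
  have hb' : Function.Bijective
      (Fin.append (fun j => z (i.succAbove j)) (Fin.cons (z i) x : Fin (q + 1) → Fin n)) := by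
    rw [he]; exact ρ.bijective.comp hb
  refine ⟨hb', ?_⟩
  rw [comp_enumSign _ _ hb hb' ρ he, Equiv.Perm.sign_permCongr, Equiv.Perm.sign_sumCongr]
  simp [Fin.sign_cycleRange]

/-- Moving the `j`-th entry of the second block to the front of the first block. -/
theorem enumSign_move_right {p q : ℕ} (w : Fin p → Fin n) (y : Fin (q + 1) → Fin n)
    (hZ : Function.Bijective (Fin.append w y)) :
    ∃ c : ℤˣ, ∀ i : Fin (q + 1), ∃ h : Function.Bijective
      (Fin.append (Fin.cons (y i) w : Fin (p + 1) → Fin n) (fun j => y (i.succAbove j))),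
      enumSign _ h = (-1) ^ i.val * c := by
  let Z : Fin p ⊕ Fin (q + 1) ≃ Fin n := finSumFinEquiv.trans (Equiv.ofBijective _ hZ)
  have hZl : ∀ i, Z (Sum.inl i) = w i := fun i => by simp [Z]
  have hZr : ∀ i, Z (Sum.inr i) = y i := fun i => by simp [Z]
  have hzx := Fin.append_injective_iff.mp hZ.1
  have hcard : p + (q + 1) = n := by
    simpa using Fintype.card_of_bijective hZ
  have hb : Function.Bijective (Fin.append (Fin.cons (y 0) w : Fin (p + 1) → Fin n)
      (fun j => y ((0 : Fin (q + 1)).succAbove j))) := by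
    rw [Fintype.bijective_iff_injective_and_card]
    refine ⟨Fin.append_injective_iff.mpr
      ⟨?_, hzx.2.1.comp Fin.succAbove_right_injective, ?_⟩, by simp; omega⟩
    · rw [Fin.cons_injective_iff]
      exact ⟨fun ⟨j, hj⟩ => hzx.2.2 j 0 hj, hzx.1⟩
    · intro a b hab
      induction a using Fin.cases with
      | zero => exact Fin.succAbove_ne 0 b (hzx.2.1 (by simpa using hab.symm))
      | succ a => exact hzx.2.2 a _ (by simpa using hab)
  refine ⟨enumSign _ hb, fun i => ?_⟩
  let ρ : Equiv.Perm (Fin n) := Z.permCongr (Equiv.Perm.sumCongr 1 i.cycleRange.symm)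
  have hρy : ∀ j, ρ (y j) = y (i.cycleRange.symm j) := by
    intro j
    simp [ρ, Equiv.permCongr_apply, ← hZr]
  have hρw : ∀ j, ρ (w j) = w j := by
    intro j
    simp [ρ, Equiv.permCongr_apply, ← hZl]
  have he : Fin.append (Fin.cons (y i) w : Fin (p + 1) → Fin n) (fun j => y (i.succAbove j))
      = ρ ∘ Fin.append (Fin.cons (y 0) w) (fun j => y ((0 : Fin (q + 1)).succAbove j)) := by
    funext a
    induction a using Fin.addCases with
    | left a =>
      induction a using Fin.cases with
      | zero => simp [hρy]
      | succ a => simp [hρw]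
    | right a => simp [hρy]
  have hb' : Function.Bijective
      (Fin.append (Fin.cons (y i) w : Fin (p + 1) → Fin n) (fun j => y (i.succAbove j))) := by
    rw [he]; exact ρ.bijective.comp hb
  refine ⟨hb', ?_⟩
  rw [comp_enumSign _ _ hb hb' ρ he, Equiv.Perm.sign_permCongr, Equiv.Perm.sign_sumCongr]
  simp [Fin.sign_cycleRange]

theorem sum_range_eq {ι κ M : Type*} [AddCommMonoid M] [Fintype ι] [Fintype κ] (z : ι → κ)
    (hz : Function.Injective z) (f : κ → M) (hf : ∀ e, e ∉ Set.range z → f e = 0) :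
    ∑ i, f (z i) = ∑ e, f e := by
  classical
  refine (Finset.sum_map Finset.univ ⟨z, hz⟩ f).symm.trans ?_
  refine Finset.sum_subset (Finset.subset_univ _) (fun e _ he => hf e ?_)
  simpa using he

theorem IsGrassmannPlucker.dual (τ : TractHom F F) {φ : (Fin r → Fin n) → F}
    (hφ : IsGrassmannPlucker φ) (hk : k + r = n) :
    IsGrassmannPlucker (dualFun τ φ : (Fin k → Fin n) → F) where
  ne_zero := by
    obtain ⟨x', hx'⟩ := hφ.ne_zero
    obtain ⟨x, hx⟩ := exists_append_bijective (k := r) (r := k) (by omega)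
      (hφ.alternating.injective hx')
    have hi := Fin.append_injective_iff.mp hx.1
    have hb : Function.Bijective (Fin.append x x') := by
      rw [Fintype.bijective_iff_injective_and_card]
      exact ⟨Fin.append_injective_iff.mpr ⟨hi.2.1, hi.1, fun a b h => hi.2.2 b a h.symm⟩,
        by simpa using hk⟩
    refine ⟨x, ?_⟩
    rw [dualFun_eq τ hφ.alternating x x' hb]
    exact mul_ne_zero (ofSign_ne_zero _) ((map_ne_zero τ.toMonoidWithZeroHom).mpr hx')
  alternating := hφ.alternating.dual τ hk
  plucker := by
    intro m h z w
    subst h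
    have halt := hφ.alternating.dual τ hk
    change ∑ i : Fin (m + 1 + 1), formal (eps F ^ (i.val + 1) *
      dualFun τ φ (fun j => z (i.succAbove j)) *
        dualFun τ φ (Fin.cons (z i) w : Fin (m + 1) → Fin n)) ∈ null (F := F)
    by_cases hz : Function.Injective z
    swap
    · simp only [Function.Injective, not_forall] at hz
      obtain ⟨a, b, hab, hne⟩ := hz
      exact halt.sum_mem_null_of_eq z a b hne hab (fun i => dualFun τ φ (Fin.cons (z i) w))
        (by simp [hab])
    by_cases hw : Function.Injective w
    swap
    · rw [Finset.sum_eq_zero]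
      · exact zero_mem_null
      · intro i _
        rw [dualFun_eq_zero τ φ (x := Fin.cons (z i) w), mul_zero, formal_zero]
        rw [Fin.cons_injective_iff]
        exact fun h => hw h.2
    obtain ⟨p, rfl⟩ : ∃ p, r = p + 1 := by
      have := Fintype.card_le_of_injective z hz
      simp only [Fintype.card_fin] at this
      exact ⟨r - 1, by omega⟩
    obtain ⟨x, hx⟩ := exists_append_bijective (r := p) (by omega) hz
    obtain ⟨y, hy⟩ := exists_append_bijective (r := p + 2) (by omega) hw
    obtain ⟨c, hc⟩ := enumSign_move_left z x hx
    obtain ⟨d, hd⟩ := enumSign_move_right w y hy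
    have hsum := τ.sum_mem_null _ _ (hφ.plucker p rfl y x)
    have hsum2 := sum_mul_mem_null _ _ (ofSign F c * ofSign F d) hsum
    let g : Fin n → F := fun e => eps F * (ofSign F c *
      τ (φ (Fin.cons e x : Fin (p + 1) → Fin n))) *
        dualFun τ φ (Fin.cons e w : Fin (m + 1) → Fin n)
    have hpp : ∀ i : ℕ, eps F ^ i * eps F ^ i = 1 := by
      intro i; rw [← mul_pow, eps_mul_eps, one_pow]
    have hτm : ∀ a b, τ (a * b) = τ a * τ b := map_mul τ.toMonoidWithZeroHom
    have hτ0 : τ 0 = 0 := map_zero τ.toMonoidWithZeroHom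
    have hτp : ∀ i : ℕ, τ (eps F ^ i) = eps F ^ i := by
      intro i
      have : τ (eps F ^ i) = τ (eps F) ^ i := map_pow τ.toMonoidWithZeroHom _ _
      rw [this, τ.map_eps]
    have hleft : ∀ i : Fin (m + 1 + 1), eps F ^ (i.val + 1) *
        dualFun τ φ (fun j => z (i.succAbove j)) *
          dualFun τ φ (Fin.cons (z i) w : Fin (m + 1) → Fin n) = g (z i) := by
      intro i
      obtain ⟨hb, hs⟩ := hc i
      rw [dualFun_eq τ hφ.alternating _ _ hb, hs, ofSign_mul, ofSign_neg_one_pow]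
      simp only [g]
      congr 1
      rw [pow_succ', mul_assoc (eps F), mul_assoc (eps F ^ i.val) (ofSign F c),
        ← mul_assoc (eps F ^ i.val) (eps F ^ i.val), hpp, one_mul]
    have hright : ∀ j : Fin (p + 1 + 1), ofSign F c * ofSign F d * τ (eps F ^ (j.val + 1) *
        φ (fun l => y (j.succAbove l)) * φ (Fin.cons (y j) x : Fin (p + 1) → Fin n))
          = g (y j) := by
      intro j
      obtain ⟨hb, hs⟩ := hd j
      simp only [g]
      rw [dualFun_eq τ hφ.alternating _ _ hb, hs, ofSign_mul, ofSign_neg_one_pow, hτm, hτm, hτp,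
        pow_succ']
      simp only [mul_comm, mul_left_comm, mul_assoc]
    have hgz : ∀ e, e ∉ Set.range z → g e = 0 := by
      intro e he
      have : e ∈ Set.range x := by rw [range_eq_compl_of_append hx]; exact he
      have h0 : φ (Fin.cons e x : Fin (p + 1) → Fin n) = 0 := by
        by_contra hne
        have := hφ.alternating.injective hne
        rw [Fin.cons_injective_iff] at this
        tauto
      simp [g, h0, hτ0]
    have hgy : ∀ e, e ∉ Set.range y → g e = 0 := by
      intro e he
      have : e ∈ Set.range w := by
        rw [range_eq_compl_of_append hy] at he; simpa using he
      have h0 : dualFun τ φ (Fin.cons e w : Fin (m + 1) → Fin n) = 0 := by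
        apply dualFun_eq_zero
        rw [Fin.cons_injective_iff]
        tauto
      simp [g, h0]
    rw [Finset.sum_congr rfl (fun i _ => congrArg formal (hleft i)),
      sum_range_eq z hz (fun e => formal (g e)) (fun e he => by simp [hgz e he, formal_zero]),
      ← sum_range_eq y (Fin.append_injective_iff.mp hy.1).2.1 (fun e => formal (g e))
        (fun e he => by simp [hgy e he, formal_zero]),
      ← Finset.sum_congr rfl (fun i _ => congrArg formal (hright i))]
    exact hsum2

end dual

/-- The type of Grassmann–Plücker functions of rank `r` on `E = Fin n`. -/
abbrev GrassmannPlucker (F : Type*) [Tract F] (n r : ℕ) : Type _ :=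
  {φ : (Fin r → Fin n) → F // IsGrassmannPlucker φ}

/-- Two Grassmann–Plücker functions are equivalent if they differ by a factor in `Fˣ`. -/
instance GrassmannPlucker.setoid (F : Type*) [Tract F] (n r : ℕ) :
    Setoid (GrassmannPlucker F n r) where
  r φ ψ := ∃ a : Fˣ, ∀ x, φ.1 x = a * ψ.1 x
  iseqv :=
    { refl := fun φ => ⟨1, fun x => by simp⟩
      symm := fun ⟨a, h⟩ => ⟨a⁻¹, fun x => by rw [h, Units.inv_mul_cancel_left]⟩
      trans := fun ⟨a, h⟩ ⟨b, h'⟩ => ⟨a * b, fun x => by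
        rw [h, h', Units.val_mul, mul_assoc]⟩ }

/-- An `F`-matroid of rank `r` on `E = Fin n`: a class of Grassmann–Plücker functions. -/
def FMatroid (F : Type*) [Tract F] (n r : ℕ) : Type _ :=
  Quotient (GrassmannPlucker.setoid F n r)

/-- `φ` represents `M`, i.e. `M = [φ]`. -/
def Represents {F : Type*} [Tract F] {n r : ℕ} (φ : GrassmannPlucker F n r)
    (M : FMatroid F n r) : Prop :=
  Quotient.mk (GrassmannPlucker.setoid F n r) φ = M

namespace FMatroid

variable {F : Type*} [Tract F] {n r : ℕ}

/-- The underlying matroid of an `F`-matroid. -/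
def underlying (M : FMatroid F n r) : Matroid (Fin n) :=
  Quotient.lift (fun φ : GrassmannPlucker F n r => φ.2.underlying) (by
    rintro φ ψ ⟨a, h⟩
    have : (fun B : Set (Fin n) => ∃ x, φ.1 x ≠ 0 ∧ Set.range x = B)
        = fun B => ∃ x, ψ.1 x ≠ 0 ∧ Set.range x = B := by
      funext B
      simp [h]
    refine Matroid.ext_isBase rfl (fun B _ => ?_)
    exact iff_of_eq (congrFun this B)) M

/-- The set `𝒞(M)` of `F`-circuits of `M = [φ]`: the vectors `X = a • X_C` with `a ∈ Fˣ` and `C` a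
circuit of the underlying matroid, where `y_0 ∈ C`, `{y_1, …, y_r}` is a basis containing
`C \ {y_0}`, and `X_C(y_i) = εⁱ φ(y_0, …, ŷ_i, …, y_r)`, `X_C(e) = 0` for all other `e`.
All choices of `φ`, `y_0` and the basis are admitted; they change `X_C` only by a unit. -/
def circuits (M : FMatroid F n r) : Set (Fin n → F) :=
  {X | ∃ φ : GrassmannPlucker F n r, Represents φ M ∧
    ∃ C : Set (Fin n), M.underlying.IsCircuit C ∧
    ∃ y : Fin (r + 1) → Fin n, y 0 ∈ C ∧
      M.underlying.IsBase (Set.range fun j : Fin r => y j.succ) ∧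
      C \ {y 0} ⊆ Set.range (fun j : Fin r => y j.succ) ∧
    ∃ a : Fˣ, (∀ i, X (y i) = a * (eps F ^ i.val * φ.1 (fun j => y (i.succAbove j)))) ∧
      ∀ e, e ∉ Set.range y → X e = 0}

/-- The dual `F`-matroid `M* = [φ*]` of `M = [φ]` with respect to `τ`. -/
noncomputable def dual (τ : TractHom F F) (M : FMatroid F n r) : FMatroid F n (n - r) :=
  Quotient.map
    (fun φ : GrassmannPlucker F n r =>
      (⟨dualFun τ φ.1, φ.2.dual τ (Nat.sub_add_cancel φ.2.rank_le)⟩ :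
        GrassmannPlucker F n (n - r)))
    (by
      rintro φ ψ ⟨a, h⟩
      refine ⟨Units.map (τ.toMonoidWithZeroHom : F →* F) a, fun x => ?_⟩
      have hm : ∀ u v, τ (u * v) = τ u * τ v := map_mul τ.toMonoidWithZeroHom
      change dualFun τ φ.1 x = τ a * dualFun τ ψ.1 x
      unfold dualFun
      split_ifs
      · rw [h, hm, mul_left_comm]
      · rw [mul_zero]) M

/-- The set `𝒞*(M)` of `F`-cocircuits of `M`: the `F`-circuits of `M*`. -/
def cocircuits (τ : TractHom F F) (M : FMatroid F n r) : Set (Fin n → F) :=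
  (M.dual τ).circuits

end FMatroid

/-- Orthogonality `X ⊥ Y` in `F^E`: the formal sum `∑ₑ X_e · τ(Y_e)` is in the nullset. -/
def Orthogonal {F : Type*} [Tract F] {n : ℕ} (τ : TractHom F F) (X Y : Fin n → F) : Prop :=
  ∑ e, formal (X e * τ (Y e)) ∈ null (F := F)

/-- Orthogonality of subsets of `F^E`. -/
def OrthogonalSets {F : Type*} [Tract F] {n : ℕ} (τ : TractHom F F)
    (𝒳 𝒴 : Set (Fin n → F)) : Prop :=
  ∀ X ∈ 𝒳, ∀ Y ∈ 𝒴, Orthogonal τ X Y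

/-- The orthogonal complement of a subset of `F^E`. -/
def orthogonalComplement {F : Type*} [Tract F] {n : ℕ} (τ : TractHom F F)
    (𝒳 : Set (Fin n → F)) : Set (Fin n → F) :=
  {X | ∀ Y ∈ 𝒳, Orthogonal τ X Y}

/-- The set `𝒱*(M) = 𝒞(M)^⊥` of `F`-covectors of `M`. -/
def FMatroid.covectors {F : Type*} [Tract F] {n r : ℕ} (τ : TractHom F F)
    (M : FMatroid F n r) : Set (Fin n → F) :=
  orthogonalComplement τ M.circuits

/-- `N ↠ M` (`M` is a quotient of `N`): every choice of Grassmann–Plücker functions `ν` and `μ`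
representing `N` and `M` satisfies the Plücker flag relations. -/
def IsQuotient {F : Type*} [Tract F] {n w r : ℕ} (N : FMatroid F n w) (M : FMatroid F n r) :
    Prop :=
  ∀ (μ : GrassmannPlucker F n r) (ν : GrassmannPlucker F n w),
    Represents μ M → Represents ν N → PluckerFlagRelations ν.1 μ.1

/-- A flag `F`-matroid: a sequence `(M_1, …, M_s)` of `F`-matroids on `E` (of arbitrary ranks)
with `M_j ↠ M_i` for all `i < j`. -/
def IsFlagMatroid {F : Type*} [Tract F] {n s : ℕ} {r : Fin s → ℕ}
    (M : ∀ i, FMatroid F n (r i)) : Prop :=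
  ∀ i j, i < j → IsQuotient (M j) (M i)

/-! The flag relations for a pair (ν, μ) are orthogonality relations in disguise. Let ν represent N,
of rank w, and let μ represent M, of rank r ≥ 1. The relation indexed by y and x pairs two vectors:
y_i ↦ εⁱ ν(…, ŷ_i, …), extended by zero, and e ↦ μ(e, x).

For injective y, the nonzero vectors of the first kind are, up to units, exactly the circuits of N
(`FMatroid.mem_circuits_iff`). After applying τ, the nonzero vectors of the second kind are, up to
units, exactly the cocircuits of M (`FMatroid.mem_cocircuits_iff`), because the sign in the dual
function absorbs the factor εⁱ. Since τ² = id and nullsets are stable under τ and under units, such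
a pair is orthogonal precisely when its flag relation holds (`orthogonal_iff_sum_mem_null`).

The remaining flag relations hold automatically: if y has a repeated entry, at most two terms
survive and they cancel; if one of the two vectors vanishes, the formal sum is zero. If r = 0, there
are neither flag relations nor cocircuits. Hence N ↠ M is equivalent to orthogonality
(`isQuotient_iff_orthogonalSets`). The theorem follows pair by pair, since covectors are by
definition the orthogonal complement of the circuits. -/

/-! ### Invariance of nullsets under the involution and under units -/

theorem TractHom.sum_mem_null_iff {F : Type*} [Tract F] {τ : TractHom F F} (hτ : τ.IsInvolution)
    {ι : Type*} (s : Finset ι) (f : ι → F) :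
    ∑ i ∈ s, formal (τ (f i)) ∈ null (F := F) ↔ ∑ i ∈ s, formal (f i) ∈ null (F := F) := by
  refine ⟨fun h => ?_, τ.sum_mem_null s f⟩
  have h' := τ.sum_mem_null s _ h
  rwa [Finset.sum_congr rfl (fun i _ => congrArg formal (hτ (f i)))] at h'

theorem Tract.sum_mul_mem_null_iff {F : Type*} [Tract F] {ι : Type*} (s : Finset ι) (f : ι → F)
    {c : F} (hc : c ≠ 0) :
    ∑ i ∈ s, formal (c * f i) ∈ null (F := F) ↔ ∑ i ∈ s, formal (f i) ∈ null (F := F) := by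
  refine ⟨fun h => ?_, sum_mul_mem_null s f c⟩
  have h' := sum_mul_mem_null s _ c⁻¹ h
  rwa [Finset.sum_congr rfl (fun i _ => congrArg formal (inv_mul_cancel_left₀ hc (f i)))] at h'

/-! ### Circuits as vectors attached to tuples -/

/-- Reordering a tuple changes its circuit vector only by a global sign. Both deletions are written
through permutations taking 0 to the deleted position, chosen so that the remaining tuples agree;
the two signs then differ by that of `ρ`. -/
theorem IsAlternating.pow_mul_succAbove_comp {F : Type*} [Tract F] {n r : ℕ}
    {φ : (Fin r → Fin n) → F} (h : IsAlternating φ) (y : Fin (r + 1) → Fin n)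
    (ρ : Equiv.Perm (Fin (r + 1))) (i : Fin (r + 1)) :
    eps F ^ i.val * φ (fun j => (y ∘ ρ) (i.succAbove j)) = ofSign F (Equiv.Perm.sign ρ) *
      (eps F ^ (ρ i).val * φ (fun j => y ((ρ i).succAbove j))) := by
  rw [h.pow_mul_succAbove (y ∘ ρ) i (Equiv.swap 0 i) (by simp),
    h.pow_mul_succAbove y (ρ i) (ρ * Equiv.swap 0 i) (by simp), Equiv.Perm.sign_mul, ofSign_mul,
    ← mul_assoc, ← mul_assoc, ofSign_mul_self, one_mul]
  rfl

theorem FMatroid.isBase_underlying_iff {F : Type*} [Tract F] {n r : ℕ} {M : FMatroid F n r}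
    {φ : GrassmannPlucker F n r} (hφ : Represents φ M) {B : Set (Fin n)} :
    M.underlying.IsBase B ↔ ∃ x, φ.1 x ≠ 0 ∧ Set.range x = B := by
  subst hφ
  exact Iff.rfl

theorem FMatroid.ground_underlying {F : Type*} [Tract F] {n r : ℕ} (M : FMatroid F n r) :
    M.underlying.E = Set.univ := by
  obtain ⟨φ, rfl⟩ := Quotient.exists_rep M
  rfl

theorem FMatroid.exists_represents {F : Type*} [Tract F] {n r : ℕ} (M : FMatroid F n r) :
    ∃ φ, Represents φ M :=
  Quotient.exists_rep M

/-- The circuits of `M = [φ]` are the unit multiples of the vectors `y_i ↦ εⁱ φ(…, ŷ_i, …)` for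
injective tuples `y` of length `r + 1` on which these values are not all zero. -/
theorem FMatroid.mem_circuits_iff {F : Type*} [Tract F] {n r : ℕ} {M : FMatroid F n r}
    {φ : GrassmannPlucker F n r} (hφ : Represents φ M) {X : Fin n → F} :
    X ∈ M.circuits ↔ ∃ y : Fin (r + 1) → Fin n, Function.Injective y ∧
      (∃ k : Fin (r + 1), φ.1 (fun j => y (k.succAbove j)) ≠ 0) ∧
      ∃ a : Fˣ, (∀ i, X (y i) = a * (eps F ^ i.val * φ.1 (fun j => y (i.succAbove j)))) ∧
        ∀ e, e ∉ Set.range y → X e = 0 := by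
  constructor
  · rintro ⟨ψ, hψ, C, hC, y, hy0, hB, hCB, a, hX, hX0⟩
    obtain ⟨b, hb⟩ : ∃ b : Fˣ, ∀ x, ψ.1 x = b * φ.1 x := Quotient.exact (hψ.trans hφ.symm)
    obtain ⟨x, hx, hxB⟩ := (isBase_underlying_iff hφ).mp hB
    have hxi := φ.2.alternating.injective hx
    -- The definition of circuits only says that the set of values is a basis. Injectivity follows
    -- by counting: the injective tuple `x` of the same length has the same range.
    have hsi : Function.Injective fun j : Fin r => y j.succ := by
      have hg : ∀ i, ∃ j : Fin r, y j.succ = x i := fun i => hxB.subset ⟨i, rfl⟩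
      choose g hg using hg
      have hgs : Function.Surjective g := Finite.surjective_of_injective fun i j hij =>
        hxi (by rw [← hg, ← hg, hij])
      intro i j hij
      obtain ⟨i, rfl⟩ := hgs i
      obtain ⟨j, rfl⟩ := hgs j
      exact congrArg g (hxi ((hg i).symm.trans (hij.trans (hg j))))
    -- Otherwise the whole circuit `C` would lie in a basis and be independent.
    have h0 : y 0 ∉ Set.range fun j : Fin r => y j.succ := by
      intro h0
      refine hC.not_indep (hB.indep.subset fun e he => ?_)
      by_cases hey : e = y 0
      · exact hey ▸ h0
      · exact hCB ⟨he, hey⟩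
    refine ⟨y, ?_, ⟨0, ?_⟩, a * b, fun i => ?_, hX0⟩
    · rw [← Fin.cons_self_tail y, Fin.cons_injective_iff]
      exact ⟨h0, hsi⟩
    · obtain ⟨π, -, hπ⟩ := φ.2.alternating.of_range_eq hxi hsi hxB
      simp only [Fin.zero_succAbove]
      rw [hπ]
      exact mul_ne_zero (ofSign_ne_zero _) hx
    · rw [hX, hb, Units.val_mul]
      ac_rfl
  · rintro ⟨y, hy, ⟨k, hk⟩, a, hX, hX0⟩
    -- The definition singles out position 0, whereas here the deletion at `k` is known to give a
    -- basis. The inverse cycle brings y_k to the front and keeps the order of the others; its sign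
    -- goes into the unit.
    have hz : ∀ j : Fin r, (y ∘ k.cycleRange.symm) j.succ = y (k.succAbove j) := fun j => by simp
    have hz0 : (y ∘ k.cycleRange.symm) 0 = y k := by simp
    have hB : M.underlying.IsBase (Set.range fun j : Fin r => y (k.succAbove j)) :=
      (isBase_underlying_iff hφ).mpr ⟨_, hk, rfl⟩
    have hkB : y k ∉ Set.range fun j : Fin r => y (k.succAbove j) := by
      rintro ⟨j, hj⟩
      exact Fin.succAbove_ne k j (hy hj)
    -- The required circuit is the fundamental circuit of y_k with respect to the basis formed by
    -- the other entries.
    refine ⟨φ, hφ, M.underlying.fundCircuit (y k) (Set.range fun j : Fin r => y (k.succAbove j)),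
      hB.fundCircuit_isCircuit (by simp [ground_underlying]) hkB, y ∘ k.cycleRange.symm, ?_, ?_, ?_,
      a * Units.mk0 (ofSign F (Equiv.Perm.sign k.cycleRange.symm)) (ofSign_ne_zero _),
      fun i => ?_, ?_⟩
    · rw [hz0]
      exact M.underlying.mem_fundCircuit _ _
    · simpa only [hz] using hB
    · simp only [hz, hz0]
      rintro e ⟨he, hne⟩
      exact (M.underlying.fundCircuit_subset_insert _ _ he).resolve_left hne
    · rw [φ.2.alternating.pow_mul_succAbove_comp, Units.val_mul, Units.val_mk0, mul_assoc,
        ← mul_assoc (ofSign F _), ofSign_mul_self, one_mul]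
      exact hX _
    · simpa [Set.range_comp] using hX0

/-! ### Cocircuits in terms of a representative of the matroid itself -/

theorem FMatroid.represents_dual {F : Type*} [Tract F] (τ : TractHom F F) {n r : ℕ}
    {M : FMatroid F n r} {φ : GrassmannPlucker F n r} (hφ : Represents φ M) :
    Represents ⟨dualFun τ φ.1, φ.2.dual τ (Nat.sub_add_cancel φ.2.rank_le)⟩ (M.dual τ) := by
  subst hφ
  rfl

/-- If `z, x` enumerates `E`, then up to a unit the vector `z_i ↦ εⁱ φ*(…, ẑ_i, …)`, extended by
zero, is `e ↦ τ(φ(e, x))`. -/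
theorem IsAlternating.exists_dualFun_eq {F : Type*} [Tract F] (τ : TractHom F F) {n k m : ℕ}
    {φ : (Fin (m + 1) → Fin n) → F} (h : IsAlternating φ) (z : Fin (k + 1) → Fin n)
    (x : Fin m → Fin n) (hzx : Function.Bijective (Fin.append z x)) :
    ∃ c : Fˣ, ∀ i : Fin (k + 1), eps F ^ i.val * dualFun τ φ (fun j => z (i.succAbove j)) =
      c * τ (φ (Fin.cons (z i) x : Fin (m + 1) → Fin n)) := by
  obtain ⟨c, hc⟩ := enumSign_move_left z x hzx
  refine ⟨Units.mk0 (ofSign F c) (ofSign_ne_zero _), fun i => ?_⟩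
  obtain ⟨hb, hs⟩ := hc i
  -- Moving z_i in front of `x` costs a sign εⁱ, up to a constant independent of i. It cancels the
  -- explicit εⁱ because ε² = 1.
  rw [dualFun_eq τ h _ _ hb, hs, ofSign_mul, ofSign_neg_one_pow, Units.val_mk0, ← mul_assoc,
    ← mul_assoc, ← mul_pow, eps_mul_eps, one_pow, one_mul]

/-- This supplies the support condition for cocircuits: e ↦ φ(e, x) lives on the complement of the
entries of x. -/
theorem IsAlternating.cons_eq_zero {F : Type*} [Tract F] {n m : ℕ}
    {φ : (Fin (m + 1) → Fin n) → F} (h : IsAlternating φ) {x : Fin m → Fin n} {e : Fin n}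
    (he : e ∈ Set.range x) : φ (Fin.cons e x : Fin (m + 1) → Fin n) = 0 := by
  by_contra hne
  exact (Fin.cons_injective_iff.mp (h.injective hne)).1 he

/-- The cocircuits of `M = [φ]` are the unit multiples of the nonzero vectors `e ↦ τ(φ(e, x))`. -/
theorem FMatroid.mem_cocircuits_iff {F : Type*} [Tract F] (τ : TractHom F F) {n m : ℕ}
    {M : FMatroid F n (m + 1)} {φ : GrassmannPlucker F n (m + 1)} (hφ : Represents φ M)
    {X : Fin n → F} :
    X ∈ M.cocircuits τ ↔ ∃ x : Fin m → Fin n,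
      (∃ e, φ.1 (Fin.cons e x : Fin (m + 1) → Fin n) ≠ 0) ∧
      ∃ a : Fˣ, ∀ e, X e = a * τ (φ.1 (Fin.cons e x : Fin (m + 1) → Fin n)) := by
  -- The truncated subtraction is exact because the rank is at most n. So a tuple giving a circuit
  -- of the dual and a complementary `x` together exhaust E.
  have hn : n - (m + 1) + 1 + m = n := by
    have := φ.2.rank_le
    omega
  have hτ0 : τ 0 = 0 := map_zero τ.toMonoidWithZeroHom
  rw [cocircuits, mem_circuits_iff (represents_dual τ hφ)]
  constructor
  · rintro ⟨z, hz, ⟨k, hk⟩, a, hX, hX0⟩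
    obtain ⟨x, hx⟩ := exists_append_bijective hn hz
    obtain ⟨c, hc⟩ := φ.2.alternating.exists_dualFun_eq τ z x hx
    refine ⟨x, ⟨z k, fun h => ?_⟩, a * c, fun e => ?_⟩
    · have := hc k
      rw [h, hτ0, mul_zero] at this
      exact mul_ne_zero (pow_ne_zero _ eps_ne_zero) hk this
    · by_cases he : e ∈ Set.range z
      · obtain ⟨i, rfl⟩ := he
        rw [hX, hc, Units.val_mul, mul_assoc]
      · rw [hX0 e he, φ.2.alternating.cons_eq_zero, hτ0, mul_zero]
        rwa [range_eq_compl_of_append hx]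
  · rintro ⟨x, ⟨e, he⟩, a, hX⟩
    have hx := φ.2.alternating.injective he
    -- Since `(e, x)` is injective, its complement can be enumerated by `z'`; then `(e, z')`
    -- enumerates the complement of `x`. Placing `e` at position 0 makes the deletion at 0 nonzero.
    obtain ⟨z', hz'⟩ := exists_append_bijective (r := n - (m + 1)) (by omega) hx
    have hi := Fin.append_injective_iff.mp hz'.1
    rw [Fin.cons_injective_iff] at hx
    have hb : Function.Bijective
        (Fin.append (Fin.cons e z' : Fin (n - (m + 1) + 1) → Fin n) x) := by
      rw [Fintype.bijective_iff_injective_and_card]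
      refine ⟨Fin.append_injective_iff.mpr ⟨?_, hx.2, fun a b h => ?_⟩, by simpa using hn⟩
      · rw [Fin.cons_injective_iff]
        exact ⟨fun ⟨j, hj⟩ => hi.2.2 0 j (by simpa using hj.symm), hi.2.1⟩
      · induction a using Fin.cases with
        | zero => exact hx.1 ⟨b, by simpa using h.symm⟩
        | succ a => exact hi.2.2 b.succ a (by simpa using h.symm)
    obtain ⟨c, hc⟩ := φ.2.alternating.exists_dualFun_eq τ _ x hb
    refine ⟨_, (Fin.append_injective_iff.mp hb.1).1, ⟨0, fun h => ?_⟩, a * c⁻¹, fun i => ?_,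
      fun f hf => ?_⟩
    · have := hc 0
      rw [show dualFun τ φ.1 _ = 0 from h, mul_zero] at this
      exact mul_ne_zero c.ne_zero ((map_ne_zero τ.toMonoidWithZeroHom).mpr he) this.symm
    · rw [hc, hX, Units.val_mul, mul_assoc, Units.inv_mul_cancel_left]
    · rw [hX, φ.2.alternating.cons_eq_zero, hτ0, mul_zero]
      rwa [range_eq_compl_of_append hb]

/-- The dual has rank n, so a circuit of it would need n + 1 distinct elements of E. This matches
the absence of flag relations in rank 0. -/
theorem FMatroid.cocircuits_eq_empty {F : Type*} [Tract F] (τ : TractHom F F) {n : ℕ}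
    (M : FMatroid F n 0) : M.cocircuits τ = ∅ := by
  obtain ⟨φ, hφ⟩ := M.exists_represents
  refine Set.eq_empty_of_forall_notMem fun X hX => ?_
  obtain ⟨y, hy, -⟩ := (mem_circuits_iff (represents_dual τ hφ)).mp hX
  simpa using Fintype.card_le_of_injective y hy

/-! ### Flag relations as orthogonality -/

/-- A cocircuit `a • τ(μ(·, x))` is orthogonal to a circuit given by `y` if and only if the Plücker
flag relation for `y` and `x` holds. -/
theorem orthogonal_iff_sum_mem_null {F : Type*} [Tract F] {τ : TractHom F F}
    (hτ : τ.IsInvolution) {n w m : ℕ} {ν : (Fin w → Fin n) → F} {μ : (Fin (m + 1) → Fin n) → F}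
    {y : Fin (w + 1) → Fin n} (hy : Function.Injective y) {x : Fin m → Fin n}
    {X Y : Fin n → F} {a b : Fˣ}
    (hX : ∀ e, X e = a * τ (μ (Fin.cons e x : Fin (m + 1) → Fin n)))
    (hY : ∀ i, Y (y i) = b * (eps F ^ i.val * ν (fun j => y (i.succAbove j))))
    (hY0 : ∀ e, e ∉ Set.range y → Y e = 0) :
    Orthogonal τ X Y ↔ ∑ k : Fin (w + 1), formal (eps F ^ (k.val + 1) *
      ν (fun j => y (k.succAbove j)) * μ (Fin.cons (y k) x : Fin (m + 1) → Fin n))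
        ∈ null (F := F) := by
  have hτ0 : τ 0 = 0 := map_zero τ.toMonoidWithZeroHom
  have hτm : ∀ u v, τ (u * v) = τ u * τ v := map_mul τ.toMonoidWithZeroHom
  -- Applying τ to the orthogonality sum frees μ from τ and turns `a` into τ(a). The extra ε
  -- converts the exponent i of the circuit into the exponent i + 1 of the flag relation.
  have hc : τ a * b * eps F ≠ 0 :=
    mul_ne_zero (mul_ne_zero ((map_ne_zero τ.toMonoidWithZeroHom).mpr a.ne_zero) b.ne_zero)
      eps_ne_zero
  rw [Orthogonal, ← sum_range_eq y hy (fun e => formal (X e * τ (Y e)))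
    (fun e he => by simp [hY0 e he, hτ0, formal_zero]), ← TractHom.sum_mem_null_iff hτ,
    ← sum_mul_mem_null_iff Finset.univ (fun k : Fin (w + 1) => _ * _ * _) hc]
  refine iff_of_eq (congrArg (· ∈ null) (Finset.sum_congr rfl fun i _ => congrArg formal ?_))
  have hpow : eps F ^ i.val = eps F * eps F ^ (i.val + 1) := by
    rw [pow_succ', ← mul_assoc, eps_mul_eps, one_mul]
  rw [hτm, hτ, hX, hY, hτm, hτ, hpow]
  ac_rfl

/-- `N ↠ M` if and only if every cocircuit of `M` is orthogonal to every circuit of `N`. -/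
theorem isQuotient_iff_orthogonalSets {F : Type*} [Tract F] {τ : TractHom F F}
    (hτ : τ.IsInvolution) {n r w : ℕ} (M : FMatroid F n r) (N : FMatroid F n w) :
    IsQuotient N M ↔ OrthogonalSets τ (M.cocircuits τ) N.circuits := by
  constructor
  · intro h X hX Y hY
    obtain ⟨μ, hμ⟩ := M.exists_represents
    obtain ⟨ν, hν⟩ := N.exists_represents
    cases r with
    | zero => simp [FMatroid.cocircuits_eq_empty] at hX
    | succ m =>
      obtain ⟨x, -, a, hX⟩ := (FMatroid.mem_cocircuits_iff τ hμ).mp hX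
      obtain ⟨y, hy, -, b, hY, hY0⟩ := (FMatroid.mem_circuits_iff hν).mp hY
      exact (orthogonal_iff_sum_mem_null hτ hy hX hY hY0).mpr (h μ ν hμ hν m rfl y x)
  · rintro h μ ν hμ hν m rfl y x
    change ∑ k : Fin (w + 1), formal (eps F ^ (k.val + 1) * ν.1 (fun j => y (k.succAbove j)) *
      μ.1 (Fin.cons (y k) x : Fin (m + 1) → Fin n)) ∈ null (F := F)
    -- For a repeated entry only the two deletions at the equal positions can be nonzero, and these
    -- terms differ by a factor ε.
    by_cases hy : Function.Injective y
    swap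
    · simp only [Function.Injective, not_forall] at hy
      obtain ⟨i, j, hij, hne⟩ := hy
      exact ν.2.alternating.sum_mem_null_of_eq y i j hne hij
        (fun k => μ.1 (Fin.cons (y k) x : Fin (m + 1) → Fin n)) (by simp [hij])
    by_cases hν0 : ∃ k : Fin (w + 1), ν.1 (fun j => y (k.succAbove j)) ≠ 0
    swap
    · push Not at hν0
      simp [hν0, formal_zero, zero_mem_null]
    by_cases hμ0 : ∃ e, μ.1 (Fin.cons e x : Fin (m + 1) → Fin n) ≠ 0
    swap
    · push Not at hμ0
      simp [hμ0, formal_zero, zero_mem_null]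
    -- Both vectors are now nonzero, so they are a genuine circuit and a genuine cocircuit, with
    -- scaling unit 1.
    let Y : Fin n → F := Function.extend y
      (fun i => eps F ^ i.val * ν.1 (fun j => y (i.succAbove j))) 0
    have hY : ∀ i, Y (y i) = (1 : Fˣ) * (eps F ^ i.val * ν.1 (fun j => y (i.succAbove j))) := by
      intro i
      rw [Units.val_one, one_mul]
      exact hy.extend_apply _ _ i
    have hY0 : ∀ e, e ∉ Set.range y → Y e = 0 := fun e he => Function.extend_apply' _ _ _ he
    have hX : ∀ e, (fun e => τ (μ.1 (Fin.cons e x : Fin (m + 1) → Fin n))) e =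
        (1 : Fˣ) * τ (μ.1 (Fin.cons e x : Fin (m + 1) → Fin n)) := by simp
    exact (orthogonal_iff_sum_mem_null hτ hy hX hY hY0).mp <|
      h _ ((FMatroid.mem_cocircuits_iff τ hμ).mpr ⟨x, hμ0, 1, hX⟩)
        _ ((FMatroid.mem_circuits_iff hν).mpr ⟨y, hy, hν0, 1, hY, hY0⟩)

theorem theorem2p3 {F : Type*} [Tract F] (τ : TractHom F F) (hτ : τ.IsInvolution) {n : ℕ} :
    (∀ {s : ℕ} {r : Fin s → ℕ} (M : ∀ i, FMatroid F n (r i)),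
      (IsFlagMatroid M ↔
        ∀ i j, i < j → (M i).cocircuits τ ⊆ (M j).covectors τ) ∧
      (IsFlagMatroid M ↔
        ∀ i j, i < j → OrthogonalSets τ ((M i).cocircuits τ) (M j).circuits)) ∧
    (∀ {r w : ℕ} (M : FMatroid F n r) (N : FMatroid F n w),
      IsQuotient N M ↔ M.cocircuits τ ⊆ N.covectors τ) := by
  have hflag : ∀ {s : ℕ} {r : Fin s → ℕ} (M : ∀ i, FMatroid F n (r i)), IsFlagMatroid M ↔
      ∀ i j, i < j → OrthogonalSets τ ((M i).cocircuits τ) (M j).circuits := fun M =>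
    forall₃_congr fun i j _ => isQuotient_iff_orthogonalSets hτ (M i) (M j)
  -- Inclusion in the covectors unfolds to orthogonality to all circuits, so the same equivalence
  -- proves both forms.
  exact ⟨fun M => ⟨hflag M, hflag M⟩, fun M N => isQuotient_iff_orthogonalSets hτ M N⟩
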